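/- Let $X$ be a complete separable metric space with its Borel $\sigma$-algebra and let $Y\subseteq\mathbb R$ be closed. Let $k:X^2\times X^2\to\mathbb R$ be a continuous kernel that is bounded, i.e. $\sup_{p\in X^2}\sqrt{k(p,p)}<\infty$, and let $H$ be the (real, automatically separable) reproducing kernel Hilbert space of functions $X^2\to\mathbb R$ with kernel $k$. Let $L:(X\times Y)^2\times\mathbb R\to[0,\infty)$ be a measurable function (a pairwise loss function) such that: - $L(x,y,x',y',\cdot)$ is convex for all $(x,y,x',y')$, and $L$ is Lipschitz continuous in its last argument: there is a constant $c\ge 0$ with $|L(x,y,x',y',t)-L(x,y,x',y',t')|\le c\,|t-t'|$ for all $x,x'\in X$, $y,y'\in Y$, $t,t'\in\mathbb R$; - $L$ is twice differentiable in its last argument, and the first and second partial derivatives $D_5L$ and $D_5D_5L$ with respect to the last argument are continuous (as functions on $(X\times Y)^2\times\mathbb R$) and bounded. Write $L^*(x,y,x',y',t):=L(x,y,x',y',t)-L(x,y,x',y',0)$ for the shifted loss function. For a data set $D=((x_1,y_1),\dots,(x_n,y_n))\in(X\times Y)^n$ let $\mathrm D_D:=\frac1n\sum_{i=1}^n\delta_{(x_i,y_i)}$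 be its empirical measure, and for a probability measure $P$ on $X\times Y$ and $\lambda>0$ let $f_{L^*,P,\lambda}$ denote the minimizer over $f\in H$ of $$\int_{(X\times Y)^2} L^*\bigl(x,y,x',y',f(x,x')\bigr)\,d(P\otimes P)(x,y,x',y')+\lambda\|f\|_H^2 .$$ Then for every $\lambda\in(0,\infty)$ and every integer $n\ge 1$, the minimizer $f_{L^*,\mathrm D_D,\lambda}\in H$ exists and is unique for every $D\in(X\times Y)^n$, and the mapping $$S_n:(X\times Y)^n\to H,\qquad S_n(D)=f_{L^*,\mathrm D_D,\lambda},$$ is continuous with respect to the product topology (metric) on $(X\times Y)^n$ and the norm metric on $H$. -/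

import Mathlib

open MeasureTheory
open scoped ENNReal

noncomputable section

namespace PairwiseLearning

section Loss

variable {X : Type*} {Y : Set ℝ}

/-- A pairwise loss function `L : (X × Y)² × ℝ → [0, ∞)`: nonnegative and (jointly) measurable. -/
structure IsPairwiseLoss [MeasurableSpace X] (L : X × Y → X × Y → ℝ → ℝ) : Prop where
  nonneg : ∀ z z' t, 0 ≤ L z z' t
  measurable : Measurable fun p : ((X × Y) × (X × Y)) × ℝ => L p.1.1 p.1.2 p.2

/-- `L` is convex in its last argument. -/
def IsConvexLoss (L : X × Y → X × Y → ℝ → ℝ) : Prop :=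
  ∀ z z', ConvexOn ℝ Set.univ (L z z')

/-- `L` is Lipschitz continuous in its last argument, uniformly in the other arguments. -/
def IsLipschitzLoss (L : X × Y → X × Y → ℝ → ℝ) : Prop :=
  ∃ c : ℝ, 0 ≤ c ∧ ∀ z z' t t', |L z z' t - L z z' t'| ≤ c * |t - t'|

/-- The first partial derivative of `L` with respect to its last argument. -/
def D5 (L : X × Y → X × Y → ℝ → ℝ) (z z' : X × Y) (t : ℝ) : ℝ :=
  deriv (L z z') t

/-- `L` is twice differentiable in its last argument, and the first and second partial derivatives
with respect to that argument are continuous functions on `(X × Y)² × ℝ` and bounded. -/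
structure HasContinuousBoundedDerivatives [TopologicalSpace X]
    (L : X × Y → X × Y → ℝ → ℝ) : Prop where
  differentiable : ∀ z z', Differentiable ℝ (L z z')
  differentiable_D5 : ∀ z z', Differentiable ℝ (D5 L z z')
  continuous_D5 : Continuous fun p : ((X × Y) × (X × Y)) × ℝ => D5 L p.1.1 p.1.2 p.2
  continuous_D5_D5 : Continuous fun p : ((X × Y) × (X × Y)) × ℝ => D5 (D5 L) p.1.1 p.1.2 p.2
  bounded_D5 : ∃ c : ℝ, 0 < c ∧ ∀ z z' t, |D5 L z z' t| ≤ c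
  bounded_D5_D5 : ∃ c : ℝ, 0 < c ∧ ∀ z z' t, |D5 (D5 L) z z' t| ≤ c

/-- The shifted loss function `L⋆(x,y,x',y',t) = L(x,y,x',y',t) - L(x,y,x',y',0)`. -/
def shiftedLoss (L : X × Y → X × Y → ℝ → ℝ) (z z' : X × Y) (t : ℝ) : ℝ :=
  L z z' t - L z z' 0

end Loss

section Kernel

variable {Z : Type*}

/-- The real Hilbert space `H` of functions on `Z` is the reproducing kernel Hilbert space of the
kernel `k`. (Mathlib's kernel of `H` takes values in the linear maps `ℝ → ℝ`; the scalar kernel is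
the value of these maps at `1`.) -/
def IsRKHSOf (H : Type*) [NormedAddCommGroup H] [InnerProductSpace ℝ H] [CompleteSpace H]
    [RKHS ℝ H Z ℝ] (k : Z → Z → ℝ) : Prop :=
  ∀ p q : Z, RKHS.kernel H p q 1 = k p q

/-- The kernel is bounded: `‖k‖_∞ = sup_p √(k(p,p)) < ∞`. -/
def IsBoundedKernel (k : Z → Z → ℝ) : Prop :=
  BddAbove (Set.range fun p : Z => Real.sqrt (k p p))

end Kernel

section Risk

variable {X : Type*} {Y : Set ℝ} [MeasurableSpace X]

/-- The risk of `f : X² → ℝ` for a (possibly signed) loss `L` and a measure `P` on `X × Y`, that is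
`∫ L(x,y,x',y',f(x,x')) dP²(x,y,x',y')`. -/
def risk (L : X × Y → X × Y → ℝ → ℝ) (P : Measure (X × Y)) (f : X × X → ℝ) : ℝ :=
  ∫ w : (X × Y) × (X × Y), L w.1 w.2 (f (w.1.1, w.2.1)) ∂(P.prod P)

/-- The empirical measure `(1/n) ∑ᵢ δ_{(xᵢ,yᵢ)}` of a data set. -/
def empiricalMeasure {n : ℕ} (D : Fin n → X × Y) : Measure (X × Y) :=
  (n : ℝ≥0∞)⁻¹ • ∑ i, Measure.dirac (D i)

variable {H : Type*} [NormedAddCommGroup H] [InnerProductSpace ℝ H] [RKHS ℝ H (X × X) ℝ]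

/-- The regularized risk `R_{L,P}(f) + lam * ‖f‖²` of `f ∈ H`. -/
def regularizedRisk (L : X × Y → X × Y → ℝ → ℝ) (P : Measure (X × Y)) (lam : ℝ) (f : H) : ℝ :=
  risk L P f + lam * ‖f‖ ^ 2

/-- `f ∈ H` minimizes the regularized risk over `H`. -/
def IsRegularizedMinimizer (L : X × Y → X × Y → ℝ → ℝ) (P : Measure (X × Y)) (lam : ℝ)
    (f : H) : Prop :=
  ∀ g : H, regularizedRisk L P lam f ≤ regularizedRisk L P lam g

variable (H) in
/-- The minimizer `f_{L,P,lam} ∈ H` of the regularized risk (an arbitrary element of `H` if there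
is no minimizer). -/
def regularizedMinimizer (L : X × Y → X × Y → ℝ → ℝ) (P : Measure (X × Y)) (lam : ℝ) : H :=
  Classical.epsilon fun f : H => IsRegularizedMinimizer L P lam f

end Risk

end PairwiseLearning

end

open Filter Topology
open scoped InnerProductSpace

namespace PairwiseLearning

section StronglyConvex

/-! For an empirical measure the regularized risk is a finite sum `J_D(f) = n⁻² ∑ l(⟪φ, f⟫) + lam
‖f‖²`, with `φ` a value of the feature map. Convexity of the losses gives `J(g) ≥ J(f) + ⟪∇J(f), g -
f⟫ + lam ‖g - f‖²` (`tikhonov_gradient_inequality`). Hence minimizing sequences are Cauchy and the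
minimizer `f_D` is unique. Taking the inequality at `f_{D₀}` towards `f_D`, with `J_D(f_D) ≤
J_D(f_{D₀})`, gives `lam ‖f_D - f_{D₀}‖ ≤ ‖∇J_D(f_{D₀})‖`. The right side is continuous in `D`,
because `D5 L` and the feature map are, and vanishes at `D₀`. -/

theorem _root_.ConvexOn.add_deriv_mul_sub_le {f : ℝ → ℝ} (hf : ConvexOn ℝ Set.univ f)
    (hd : Differentiable ℝ f) (s t : ℝ) : f s + deriv f s * (t - s) ≤ f t := by
  rcases lt_trichotomy s t with h | rfl | h
  · have := hf.deriv_le_slope (Set.mem_univ s) (Set.mem_univ t) h (hd s)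
    rw [slope_def_field, le_div_iff₀ (sub_pos.2 h)] at this
    linarith
  · simp
  · have := hf.slope_le_deriv (Set.mem_univ t) (Set.mem_univ s) h (hd s)
    rw [slope_def_field, div_le_iff₀ (sub_pos.2 h)] at this
    linarith

variable {ι H : Type*} [Fintype ι] [NormedAddCommGroup H] [InnerProductSpace ℝ H]

/-- A weighted sum of losses of linear functionals, with a Tikhonov regularization term. -/
noncomputable def tikhonov (a lam : ℝ) (φ : ι → H) (l : ι → ℝ → ℝ) (f : H) : ℝ :=
  a * ∑ i, l i ⟪φ i, f⟫_ℝ + lam * ‖f‖ ^ 2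

/-- The gradient of `tikhonov`. -/
noncomputable def tikhonovGrad (a lam : ℝ) (φ : ι → H) (l : ι → ℝ → ℝ) (f : H) : H :=
  a • ∑ i, deriv (l i) ⟪φ i, f⟫_ℝ • φ i + (2 * lam) • f

variable {a lam : ℝ} {φ : ι → H} {l : ι → ℝ → ℝ}

/-- Each loss lies above its tangent line, while the squared norm expands exactly; its second-order
remainder is the term `lam * ‖g - f‖ ^ 2`. -/
theorem tikhonov_gradient_inequality (ha : 0 ≤ a) (hc : ∀ i, ConvexOn ℝ Set.univ (l i))
    (hd : ∀ i, Differentiable ℝ (l i)) (f g : H) :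
    tikhonov a lam φ l f + ⟪tikhonovGrad a lam φ l f, g - f⟫_ℝ + lam * ‖g - f‖ ^ 2 ≤
      tikhonov a lam φ l g := by
  have h1 : a * ∑ i, (l i ⟪φ i, f⟫_ℝ + deriv (l i) ⟪φ i, f⟫_ℝ * (⟪φ i, g⟫_ℝ - ⟪φ i, f⟫_ℝ)) ≤
      a * ∑ i, l i ⟪φ i, g⟫_ℝ :=
    mul_le_mul_of_nonneg_left
      (Finset.sum_le_sum fun i _ => (hc i).add_deriv_mul_sub_le (hd i) _ _) ha
  rw [Finset.sum_add_distrib, mul_add] at h1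
  have h2 : ‖g - f‖ ^ 2 = ‖g‖ ^ 2 - 2 * ⟪f, g⟫_ℝ + ‖f‖ ^ 2 := by
    rw [norm_sub_sq_real, real_inner_comm]
  have h3 : ⟪tikhonovGrad a lam φ l f, g - f⟫_ℝ =
      a * ∑ i, deriv (l i) ⟪φ i, f⟫_ℝ * (⟪φ i, g⟫_ℝ - ⟪φ i, f⟫_ℝ) +
        2 * lam * (⟪f, g⟫_ℝ - ‖f‖ ^ 2) := by
    simp only [tikhonovGrad, inner_add_left, real_inner_smul_left, sum_inner, inner_sub_right,
      real_inner_self_eq_norm_sq, mul_sub, Finset.sum_sub_distrib]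
    ring
  rw [h3, h2]
  unfold tikhonov
  linarith

/-- Along the line through `f` in the direction `v` of the gradient itself, the derivative at `0` is
`⟪v, v⟫`, which must vanish at a minimum. -/
theorem tikhonovGrad_eq_zero_of_forall_le (hd : ∀ i, Differentiable ℝ (l i)) {f : H}
    (hf : ∀ g, tikhonov a lam φ l f ≤ tikhonov a lam φ l g) : tikhonovGrad a lam φ l f = 0 := by
  set v := tikhonovGrad a lam φ l f with hv
  have key : HasDerivAt (fun t : ℝ => tikhonov a lam φ l (f + t • v)) ⟪v, v⟫_ℝ 0 := by
    have hlin : ∀ i, HasDerivAt (fun t : ℝ => l i (⟪φ i, f⟫_ℝ + t * ⟪φ i, v⟫_ℝ))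
        (deriv (l i) ⟪φ i, f⟫_ℝ * ⟪φ i, v⟫_ℝ) 0 := fun i => by
      have h := ((hasDerivAt_id (0 : ℝ)).mul_const ⟪φ i, v⟫_ℝ).const_add ⟪φ i, f⟫_ℝ
      have h' : HasDerivAt (l i) (deriv (l i) ⟪φ i, f⟫_ℝ)
          (⟪φ i, f⟫_ℝ + id (0 : ℝ) * ⟪φ i, v⟫_ℝ) := by
        simpa using (hd i ⟪φ i, f⟫_ℝ).hasDerivAt
      exact (h'.comp (0 : ℝ) h).congr_deriv (by simp)
    have hsq : HasDerivAt (fun t : ℝ => ‖f‖ ^ 2 + t * (2 * ⟪f, v⟫_ℝ) + t ^ 2 * ‖v‖ ^ 2)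
        (2 * ⟪f, v⟫_ℝ) 0 := by
      have h := (((hasDerivAt_id (0 : ℝ)).mul_const (2 * ⟪f, v⟫_ℝ)).const_add (‖f‖ ^ 2)).add
        ((hasDerivAt_pow 2 (0 : ℝ)).mul_const (‖v‖ ^ 2))
      exact h.congr_deriv (by simp)
    have h := ((HasDerivAt.fun_sum fun i (_ : i ∈ Finset.univ) => hlin i).const_mul a).add
      (hsq.const_mul lam)
    have hfun : (fun t : ℝ => tikhonov a lam φ l (f + t • v)) = fun t : ℝ =>
        a * ∑ i, l i (⟪φ i, f⟫_ℝ + t * ⟪φ i, v⟫_ℝ) +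
          lam * (‖f‖ ^ 2 + t * (2 * ⟪f, v⟫_ℝ) + t ^ 2 * ‖v‖ ^ 2) := by
      funext t
      simp only [tikhonov, inner_add_right, real_inner_smul_right]
      rw [norm_add_sq_real, real_inner_smul_right, norm_smul, mul_pow, Real.norm_eq_abs, sq_abs]
      ring
    have hinner : ∀ w, ⟪v, w⟫_ℝ =
        a * ∑ i, deriv (l i) ⟪φ i, f⟫_ℝ * ⟪φ i, w⟫_ℝ + lam * (2 * ⟪f, w⟫_ℝ) := fun w => by
      simp only [hv, tikhonovGrad, inner_add_left, real_inner_smul_left, sum_inner]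
      ring
    rw [hfun, hinner v]
    exact h
  have hmin : IsLocalMin (fun t : ℝ => tikhonov a lam φ l (f + t • v)) 0 :=
    Eventually.of_forall fun t => by simpa using hf (f + t • v)
  exact inner_self_eq_zero.1 (hmin.hasDerivAt_eq_zero key)

theorem mul_norm_sub_sq_le_of_tikhonovGrad_eq_zero (ha : 0 ≤ a)
    (hc : ∀ i, ConvexOn ℝ Set.univ (l i)) (hd : ∀ i, Differentiable ℝ (l i)) {f : H}
    (hf : tikhonovGrad a lam φ l f = 0) (g : H) :
    tikhonov a lam φ l f + lam * ‖g - f‖ ^ 2 ≤ tikhonov a lam φ l g := by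
  simpa [hf] using tikhonov_gradient_inequality (lam := lam) (φ := φ) ha hc hd f g

/-- The distance of any point to the minimizer is controlled by the gradient at that point. -/
theorem mul_norm_sub_le_norm_tikhonovGrad (ha : 0 ≤ a)
    (hc : ∀ i, ConvexOn ℝ Set.univ (l i)) (hd : ∀ i, Differentiable ℝ (l i)) {f : H}
    (hf : ∀ g, tikhonov a lam φ l f ≤ tikhonov a lam φ l g) (g : H) :
    lam * ‖f - g‖ ≤ ‖tikhonovGrad a lam φ l g‖ := by
  rcases (norm_nonneg (f - g)).eq_or_lt with h0 | h0
  · rw [← h0, mul_zero]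
    exact norm_nonneg _
  have h1 := tikhonov_gradient_inequality (lam := lam) (φ := φ) ha hc hd g f
  have h2 := neg_le_of_abs_le (abs_real_inner_le_norm (tikhonovGrad a lam φ l g) (f - g))
  refine le_of_mul_le_mul_right ?_ h0
  linarith [hf g]

theorem existsUnique_tikhonov_minimizer [CompleteSpace H] (ha : 0 ≤ a) (hlam : 0 < lam)
    (hc : ∀ i, ConvexOn ℝ Set.univ (l i)) (hd : ∀ i, Differentiable ℝ (l i))
    (hbdd : ∀ i, BddBelow (Set.range (l i))) :
    ∃! f : H, ∀ g, tikhonov a lam φ l f ≤ tikhonov a lam φ l g := by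
  choose b hb using hbdd
  set F : H → ℝ := tikhonov a lam φ l with hF
  have hcont : Continuous F := by
    have : ∀ i, Continuous (l i) := fun i => (hd i).continuous
    rw [hF]
    unfold tikhonov
    fun_prop
  have hne : (Set.range F).Nonempty := Set.range_nonempty F
  have hbelow : BddBelow (Set.range F) := by
    refine ⟨a * ∑ i, b i, ?_⟩
    rintro _ ⟨f, rfl⟩
    have h1 : a * ∑ i, b i ≤ a * ∑ i, l i ⟪φ i, f⟫_ℝ :=
      mul_le_mul_of_nonneg_left (Finset.sum_le_sum fun i _ => hb i ⟨_, rfl⟩) ha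
    have h2 : 0 ≤ lam * ‖f‖ ^ 2 := by positivity
    simp only [hF, tikhonov]
    linarith
  -- The gradient inequality at the midpoint, towards `u` and towards `v`: the linear terms cancel
  -- in the sum, and each quadratic term is `lam / 4 * ‖u - v‖ ^ 2`.
  have hmid : ∀ u v : H, lam / 2 * ‖u - v‖ ^ 2 ≤ F u + F v - 2 * sInf (Set.range F) := by
    intro u v
    have hm := csInf_le hbelow ⟨(2⁻¹ : ℝ) • (u + v), rfl⟩
    have hu := tikhonov_gradient_inequality (lam := lam) (φ := φ) ha hc hd ((2⁻¹ : ℝ) • (u + v)) u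
    have hv := tikhonov_gradient_inequality (lam := lam) (φ := φ) ha hc hd ((2⁻¹ : ℝ) • (u + v)) v
    have eu : u - (2⁻¹ : ℝ) • (u + v) = (2⁻¹ : ℝ) • (u - v) := by module
    have ev : v - (2⁻¹ : ℝ) • (u + v) = -((2⁻¹ : ℝ) • (u - v)) := by module
    have en : ‖(2⁻¹ : ℝ) • (u - v)‖ ^ 2 = ‖u - v‖ ^ 2 / 4 := by
      rw [norm_smul, mul_pow, Real.norm_eq_abs, sq_abs]
      ring
    rw [eu, en] at hu
    rw [ev, inner_neg_right, norm_neg, en] at hv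
    linarith
  obtain ⟨y, -, hy, hyF⟩ := exists_seq_tendsto_sInf hne hbelow
  choose u hu using hyF
  have hlim : Tendsto (fun n => F (u n)) atTop (𝓝 (sInf (Set.range F))) := by simpa only [hu] using hy
  have hcauchy : CauchySeq u := by
    rw [Metric.cauchySeq_iff']
    intro ε hε
    -- Two excesses below `lam / 4 * ε ^ 2` match the factor `lam / 2` in `hmid`.
    obtain ⟨N, hN⟩ := (hlim.eventually
      (gt_mem_nhds (lt_add_of_pos_right _ (show 0 < lam / 4 * ε ^ 2 by positivity)))).exists_forall_of_atTop
    refine ⟨N, fun n hn => ?_⟩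
    have h := hmid (u n) (u N)
    rw [dist_eq_norm]
    refine lt_of_pow_lt_pow_left₀ 2 hε.le ?_
    refine lt_of_mul_lt_mul_left ?_ (half_pos hlam).le
    linarith [hN n hn, hN N le_rfl]
  obtain ⟨f, hf⟩ := cauchySeq_tendsto_of_complete hcauchy
  have hFf : F f = sInf (Set.range F) := tendsto_nhds_unique ((hcont.tendsto f).comp hf) hlim
  have hmin : ∀ g, F f ≤ F g := fun g => hFf.trans_le (csInf_le hbelow ⟨g, rfl⟩)
  refine ⟨f, hmin, fun g hg => ?_⟩
  have h := mul_norm_sub_sq_le_of_tikhonovGrad_eq_zero ha hc hd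
    (tikhonovGrad_eq_zero_of_forall_le hd hmin) g
  have h0 : lam * ‖g - f‖ ^ 2 ≤ 0 := by linarith [hg f]
  have h1 : ‖g - f‖ ^ 2 ≤ 0 := nonpos_of_mul_nonpos_right h0 hlam
  exact sub_eq_zero.1 (norm_eq_zero.1 (pow_eq_zero_iff two_ne_zero |>.1 (h1.antisymm (sq_nonneg _))))

end StronglyConvex

/-! ### Continuity of the feature map -/

section Kernel

variable {Z H : Type*} [NormedAddCommGroup H] [InnerProductSpace ℝ H] [CompleteSpace H]
  [RKHS ℝ H Z ℝ]

variable (H) in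
/-- The canonical feature map of a reproducing kernel Hilbert space of real functions. -/
noncomputable def featureMap (p : Z) : H := RKHS.kerFun H p 1

theorem inner_featureMap (p : Z) (f : H) : ⟪featureMap H p, f⟫_ℝ = f p := by
  simp [featureMap, RKHS.kerFun_inner]

theorem IsRKHSOf.inner_featureMap_featureMap {k : Z → Z → ℝ} (hk : IsRKHSOf H k) (p q : Z) :
    ⟪featureMap H p, featureMap H q⟫_ℝ = k p q := by
  rw [inner_featureMap, featureMap, RKHS.kerFun_apply, hk]

/-- The squared distance of two features is `k p p - 2 * k p q + k q q`, which tends to `0` as `p →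
q`. -/
theorem IsRKHSOf.continuous_featureMap [TopologicalSpace Z] {k : Z → Z → ℝ} (hk : IsRKHSOf H k)
    (hc : Continuous fun p : Z × Z => k p.1 p.2) : Continuous (featureMap H : Z → H) := by
  rw [continuous_iff_continuousAt]
  intro q
  rw [ContinuousAt, tendsto_iff_norm_sub_tendsto_zero]
  have hdist : ∀ p, ‖featureMap H p - featureMap H q‖ = √(k p p - 2 * k p q + k q q) := fun p => by
    rw [← Real.sqrt_sq (norm_nonneg (featureMap H p - featureMap H q)), norm_sub_sq_real,
      ← real_inner_self_eq_norm_sq, ← real_inner_self_eq_norm_sq, hk.inner_featureMap_featureMap,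
      hk.inner_featureMap_featureMap, hk.inner_featureMap_featureMap]
  have h1 : Continuous fun p => k p p := hc.comp (continuous_id.prodMk continuous_id)
  have h2 : Continuous fun p => k p q := hc.comp (continuous_id.prodMk continuous_const)
  have h3 : Continuous fun p => √(k p p - 2 * k p q + k q q) := by fun_prop
  have h4 := h3.tendsto q
  rw [show k q q - 2 * k q q + k q q = 0 by ring, Real.sqrt_zero] at h4
  simpa only [hdist] using h4

end Kernel

/-! ### Empirical risks as finite sums -/

section Empirical

variable {X : Type*} {Y : Set ℝ}

theorem empiricalMeasure_prod_self [MeasurableSpace X] {n : ℕ} (hn : n ≠ 0) (D : Fin n → X × Y) :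
    (empiricalMeasure D).prod (empiricalMeasure D) =
      ((n : ℝ≥0∞)⁻¹ * (n : ℝ≥0∞)⁻¹) •
        ∑ p : Fin n × Fin n, Measure.dirac (D p.1, D p.2) := by
  have htop : (n : ℝ≥0∞)⁻¹ ≠ ∞ := by simpa using hn
  unfold empiricalMeasure
  rw [Measure.prod_smul_left, Measure.prod_smul_right, smul_smul, ← Measure.sum_fintype,
    Measure.prod_sum, Measure.sum_fintype]
  simp only [Measure.dirac_prod_dirac]

theorem risk_empiricalMeasure [MeasurableSpace X] [MeasurableSingletonClass X] {n : ℕ}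
    (hn : n ≠ 0) (L : X × Y → X × Y → ℝ → ℝ) (D : Fin n → X × Y) (f : X × X → ℝ) :
    risk L (empiricalMeasure D) f =
      ((n : ℝ)⁻¹ * (n : ℝ)⁻¹) *
        ∑ p : Fin n × Fin n, L (D p.1) (D p.2) (f ((D p.1).1, (D p.2).1)) := by
  unfold risk
  rw [empiricalMeasure_prod_self hn, integral_smul_measure, integral_finsetSum_measure]
  · simp [integral_dirac]
  · exact fun p _ => integrable_dirac (by simp)

variable {H : Type*} [NormedAddCommGroup H] [InnerProductSpace ℝ H] [CompleteSpace H]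
  [RKHS ℝ H (X × X) ℝ]

theorem regularizedRisk_empiricalMeasure [MeasurableSpace X] [MeasurableSingletonClass X] {n : ℕ}
    (hn : n ≠ 0) (L : X × Y → X × Y → ℝ → ℝ) (D : Fin n → X × Y) (lam : ℝ) (f : H) :
    regularizedRisk L (empiricalMeasure D) lam f =
      tikhonov ((n : ℝ)⁻¹ * (n : ℝ)⁻¹) lam
        (fun p : Fin n × Fin n => featureMap H ((D p.1).1, (D p.2).1))
        (fun p => L (D p.1) (D p.2)) f := by
  unfold regularizedRisk tikhonov
  rw [risk_empiricalMeasure hn]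
  simp only [inner_featureMap]

theorem deriv_shiftedLoss (L : X × Y → X × Y → ℝ → ℝ) (z z' : X × Y) (t : ℝ) :
    deriv (shiftedLoss L z z') t = D5 L z z' t :=
  deriv_sub_const _

end Empirical

end PairwiseLearning

open PairwiseLearning in
theorem mainTheorem11
    {X : Type*} [MetricSpace X] [CompleteSpace X] [TopologicalSpace.SeparableSpace X]
    [MeasurableSpace X] [BorelSpace X]
    {Y : Set ℝ} (hY : IsClosed Y)
    {H : Type*} [NormedAddCommGroup H] [InnerProductSpace ℝ H] [CompleteSpace H]
    [RKHS ℝ H (X × X) ℝ]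
    (k : X × X → X × X → ℝ) (hkH : PairwiseLearning.IsRKHSOf H k)
    (hk_cont : Continuous fun p : (X × X) × (X × X) => k p.1 p.2)
    (hk_bdd : PairwiseLearning.IsBoundedKernel k)
    (L : X × Y → X × Y → ℝ → ℝ) (hL : PairwiseLearning.IsPairwiseLoss L)
    (hL_lip : PairwiseLearning.IsLipschitzLoss L)
    (hL_conv : PairwiseLearning.IsConvexLoss L)
    (hL_diff : PairwiseLearning.HasContinuousBoundedDerivatives L)
    (lam : ℝ) (hlam : 0 < lam) (n : ℕ) (hn : 1 ≤ n) :
    (∀ D : Fin n → X × Y, ∃! f : H,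
      PairwiseLearning.IsRegularizedMinimizer (PairwiseLearning.shiftedLoss L)
        (PairwiseLearning.empiricalMeasure D) lam f) ∧
    Continuous fun D : Fin n → X × Y =>
      PairwiseLearning.regularizedMinimizer H (PairwiseLearning.shiftedLoss L)
        (PairwiseLearning.empiricalMeasure D) lam := by
  have hn0 : n ≠ 0 := by omega
  have ha : (0 : ℝ) ≤ (n : ℝ)⁻¹ * (n : ℝ)⁻¹ := by positivity
  have hc : ∀ z z', ConvexOn ℝ Set.univ (shiftedLoss L z z') := fun z z' =>
    (hL_conv z z').add_const (-L z z' 0)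
  have hd : ∀ z z', Differentiable ℝ (shiftedLoss L z z') := fun z z' =>
    (hL_diff.differentiable z z').sub_const _
  have hb : ∀ z z', BddBelow (Set.range (shiftedLoss L z z')) := fun z z' => by
    refine ⟨-L z z' 0, ?_⟩
    rintro _ ⟨t, rfl⟩
    have := hL.nonneg z z' t
    simp only [shiftedLoss]
    linarith
  have hex : ∀ D : Fin n → X × Y, ∃! f : H,
      IsRegularizedMinimizer (shiftedLoss L) (empiricalMeasure D) lam f := fun D => by
    simp only [IsRegularizedMinimizer, regularizedRisk_empiricalMeasure hn0]
    exact existsUnique_tikhonov_minimizer ha hlam (fun _ => hc _ _) (fun _ => hd _ _)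
      (fun _ => hb _ _)
  refine ⟨hex, ?_⟩
  set S : (Fin n → X × Y) → H := fun D =>
    regularizedMinimizer H (shiftedLoss L) (empiricalMeasure D) lam
  have hS : ∀ D, IsRegularizedMinimizer (shiftedLoss L) (empiricalMeasure D) lam (S D) :=
    fun D => Classical.epsilon_spec (hex D).exists
  simp only [IsRegularizedMinimizer, regularizedRisk_empiricalMeasure hn0] at hS
  have hΦ : Continuous (featureMap H : X × X → H) := hkH.continuous_featureMap hk_cont
  rw [continuous_iff_continuousAt]
  intro D₀
  -- The gradient for the data `D` is taken at the fixed point `S D₀`, so its continuity in `D`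
  -- presupposes nothing about `S`.
  let G : (Fin n → X × Y) → H := fun D =>
    tikhonovGrad ((n : ℝ)⁻¹ * (n : ℝ)⁻¹) lam
      (fun p : Fin n × Fin n => featureMap H ((D p.1).1, (D p.2).1))
      (fun p => shiftedLoss L (D p.1) (D p.2)) (S D₀)
  have hG : Continuous G := by
    simp only [G, tikhonovGrad, deriv_shiftedLoss]
    have hφ : ∀ p : Fin n × Fin n, Continuous fun D : Fin n → X × Y =>
        featureMap H ((D p.1).1, (D p.2).1) := fun p => hΦ.comp (by fun_prop)
    have hD5 : ∀ p : Fin n × Fin n, Continuous fun D : Fin n → X × Y =>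
        D5 L (D p.1) (D p.2) ⟪featureMap H ((D p.1).1, (D p.2).1), S D₀⟫_ℝ := fun p =>
      hL_diff.continuous_D5.comp (f := fun D : Fin n → X × Y =>
        ((D p.1, D p.2), ⟪featureMap H ((D p.1).1, (D p.2).1), S D₀⟫_ℝ))
        (((continuous_apply _).prodMk (continuous_apply _)).prodMk
          ((hφ p).inner continuous_const))
    exact ((continuous_finsetSum _ fun p _ => (hD5 p).smul (hφ p)).const_smul _).add
      continuous_const
  have hG0 : G D₀ = 0 := tikhonovGrad_eq_zero_of_forall_le (fun _ => hd _ _) (hS D₀)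
  rw [ContinuousAt, tendsto_iff_norm_sub_tendsto_zero]
  have hlim : Tendsto (fun D => lam⁻¹ * ‖G D‖) (𝓝 D₀) (𝓝 0) := by
    have h := (hG.norm.const_mul lam⁻¹).tendsto D₀
    rwa [hG0, norm_zero, mul_zero] at h
  refine squeeze_zero (fun _ => norm_nonneg _) (fun D => ?_) hlim
  rw [le_inv_mul_iff₀ hlam]
  exact mul_norm_sub_le_norm_tikhonovGrad ha (fun _ => hc _ _) (fun _ => hd _ _) (hS D) (S D₀)
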